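/- Let $\Delta=\{p\in\mathbb{R}^n: p_i>0,\ \sum_i p_i=1\}$ and $\overline{\Delta}=\{p\in\mathbb{R}^n: p_i\ge 0,\ \sum_i p_i=1\}$. A portfolio function is a map $\pi:\Delta\to\overline{\Delta}$. Along a sequence $\{\mu(t)\}_{t\ge 0}\subset\Delta$ its relative value is $V(0)=1$, $V(t+1)=V(t)\sum_{i}\pi_i(\mu(t))\,\mu_i(t+1)/\mu_i(t)$. For $K\subset\Delta$, $\pi$ is a pseudo-arbitrage on $K$ if (a) there is $C\ge 0$ such that $\log V(t)\ge -C$ for all $t\ge 0$ and all sequences $\{\mu(t)\}\subset K$, and (b) there is a sequence in $K$ along which $V(t)\to\infty$. A concave function $\Phi:\Delta\to(0,\infty)$ is said to generate $\pi$ on $K$ if for every $p\in K$ the tangent vector $v_i=\frac{\pi_i(p)}{p_i}-\frac1n\sum_{j}\frac{\pi_j(p)}{p_j}$ is a supergradient of $\log\Phi$ at $p$, that is, $\log\Phi(q)\le\log\Phi(p)+\langle v,q-p\rangle$ for all $q\in\Delta$. On $\overline{\Delta}\times[-\infty,\infty)^n$ consider the cost $c(\mu,h)=\log\left(\sum_{i=1}^n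 e^{h_i}\mu_i\right)\in[-\infty,\infty)$. For Borel probability measures $\mathcal{P}$ on $\overline\Delta$ and $\mathcal{Q}$ on $[-\infty,\infty)^n$, the transport problem is to minimize $\mathrm{E}_{\mathcal{R}}[c(\mu,h)]$ over the couplings $\mathcal{R}$ of $(\mathcal{P},\mathcal{Q})$ for which this expectation is well defined in $[-\infty,\infty]$; its infimum is called the value, and a coupling attaining it is called optimal. **Theorem.** (1) Let $\mathcal{P}$ be concentrated on $\Delta$, let $\mathcal{Q}$ be a probability measure on $[-\infty,\infty)^n$ (for example on $\mathbb{R}^n$), and suppose that the value is finite and that $\mathcal{R}$ is an optimal coupling. Let $K\subset\Delta$ and let $F:K\to[-\infty,\infty)^n\setminus\{(-\infty,\dots,-\infty)\}$ be such that $(\mu,F(\mu))$ belongs to the support of $\mathcal{R}$ for all $\mu\in K$. Let $\pi$ be a portfolio function which on $K$ is given by $$\frac{\pi_i(\mu)}{\mu_i}=\frac{e^{h_i}}{\sum_{j}e^{h_j}\mu_j},\qquad h=F(\mu),\quad i=1,\dots,n.$$ Then there exists a concave function $\Phi:\Delta\to(0,\infty)$ that generates $\pi$ on $K$. Moreover,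 if $K$ is open in $\Delta$ and convex, and if a concave function $\Phi:\Delta\to(0,\infty)$ that generates $\pi$ on $K$ is such that (i) $\Phi|_K$ is not affine and (ii) there is $\varepsilon>0$ with $\Phi\ge\varepsilon$ on $K$, then $\pi$ is a pseudo-arbitrage on $K$. (2) Conversely, let $\pi$ be a pseudo-arbitrage on a subset $K\subset\Delta$ and define $T(\mu)\in[-\infty,\infty)^n$ by $T_i(\mu)=\log(\pi_i(\mu)/\mu_i)$. Suppose that each coordinate of $T$ is bounded below on $K$ by a real number. Let $\mathcal{P}$ be any Borel probability measure on $K$ for which $T$ is $\mathcal{P}$-measurable, and let $\mathcal{Q}$ be the distribution of $T(\mu)$ when $\mu\sim\mathcal{P}$. Then the coupling $(\mu,T(\mu))$, $\mu\sim\mathcal{P}$, is optimal for the transport problem with cost $c$ and marginals $\mathcal{P}$, $\mathcal{Q}$. -/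

import Mathlib

open MeasureTheory Filter

noncomputable section

namespace PseudoArbitrage

/-! ### Simplices and portfolios -/

/-- The open unit simplex in `ℝⁿ`. -/
def openSimplex (n : ℕ) : Set (Fin n → ℝ) :=
  {p | (∀ i, 0 < p i) ∧ ∑ i, p i = 1}

/-- The closed unit simplex in `ℝⁿ`, as a space. -/
abbrev ClosedSimplex (n : ℕ) : Type := stdSimplex ℝ (Fin n)

/-- The inclusion of the open simplex into the closed simplex. -/
def toClosed {n : ℕ} (p : openSimplex n) : ClosedSimplex n :=
  ⟨p.1, fun i => (p.2.1 i).le, p.2.2⟩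

/-- A portfolio function: a map from the open simplex (market weights) to the closed simplex
(portfolio weights). -/
abbrev Portfolio (n : ℕ) : Type := openSimplex n → ClosedSimplex n

/-- The relative value process: `V 0 = 1` and
`V (t + 1) = V t * ∑ i, π i (μ t) * μ i (t + 1) / μ i t`. -/
def relativeValue {n : ℕ} (π : Portfolio n) (μ : ℕ → openSimplex n) : ℕ → ℝ
  | 0 => 1
  | t + 1 => relativeValue π μ t * ∑ i, (π (μ t)).1 i * ((μ (t + 1)).1 i / (μ t).1 i)

/-- `π` is a pseudo-arbitrage on `K`. -/
def IsPseudoArbitrage {n : ℕ} (K : Set (openSimplex n)) (π : Portfolio n) : Prop :=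
  (∃ C : ℝ, 0 ≤ C ∧ ∀ μ : ℕ → openSimplex n, (∀ t, μ t ∈ K) →
      ∀ t, -C ≤ Real.log (relativeValue π μ t)) ∧
  (∃ μ : ℕ → openSimplex n, (∀ t, μ t ∈ K) ∧ Tendsto (relativeValue π μ) atTop atTop)

/-! ### Generating functions -/

/-- `v` is a supergradient at `p` of the function `f` on the open simplex: a tangent vector of the
simplex with `f q ≤ f p + ⟨v, q - p⟩` for all `q` in the open simplex. -/
def IsSupergradientAt {n : ℕ} (f : (Fin n → ℝ) → ℝ) (p : openSimplex n) (v : Fin n → ℝ) : Prop :=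
  ∑ i, v i = 0 ∧ ∀ q : openSimplex n, f q.1 ≤ f p.1 + ∑ i, v i * (q.1 i - p.1 i)

/-- The component tangent to the simplex of the vector `π(p)/p` of coordinatewise ratios. -/
def tangentRatio {n : ℕ} (π : Portfolio n) (p : openSimplex n) : Fin n → ℝ := fun i =>
  (π p).1 i / p.1 i - (1 / (n : ℝ)) * ∑ j, (π p).1 j / p.1 j

/-- The positive concave function `Φ` on the open simplex generates `π` on `K`: for every `p ∈ K`
the vector `π(p)/p` defines a supergradient of `log Φ` at `p`. -/
structure Generates {n : ℕ} (Φ : (Fin n → ℝ) → ℝ) (K : Set (openSimplex n)) (π : Portfolio n) :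
    Prop where
  concave : ConcaveOn ℝ (openSimplex n) Φ
  pos : ∀ p ∈ openSimplex n, 0 < Φ p
  supergradient : ∀ p ∈ K, IsSupergradientAt (fun q => Real.log (Φ q)) p (tangentRatio π p)

/-- The restriction of `Φ` to `K` is affine. -/
def IsAffineOn {n : ℕ} (Φ : (Fin n → ℝ) → ℝ) (K : Set (openSimplex n)) : Prop :=
  ∃ l : (Fin n → ℝ) →ᵃ[ℝ] ℝ, ∀ p ∈ K, Φ p.1 = l p.1

/-! ### The Monge-Kantorovich problem -/

section Transport

variable {X Y : Type*} [MeasurableSpace X] [MeasurableSpace Y]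

/-- `R` is a coupling of `P` and `Q`. -/
structure IsCoupling (P : Measure X) (Q : Measure Y) (R : Measure (X × Y)) : Prop where
  isProbability : IsProbabilityMeasure R
  fst_eq : R.map Prod.fst = P
  snd_eq : R.map Prod.snd = Q

/-- The expectation of `c` under `R` is well defined in `[-∞, ∞]`: the positive and the negative
part of `c` do not both have infinite integral. -/
def HasExpectation (R : Measure (X × Y)) (c : X × Y → EReal) : Prop :=
  lintegral R (fun z => (c z).toENNReal) ≠ ⊤ ∨ lintegral R (fun z => (-c z).toENNReal) ≠ ⊤

/-- The expectation of `c` under `R`, meaningful when `HasExpectation R c`. -/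
def expectation (R : Measure (X × Y)) (c : X × Y → EReal) : EReal :=
  (lintegral R (fun z => (c z).toENNReal) : EReal) - (lintegral R (fun z => (-c z).toENNReal) : EReal)

/-- The value of the transport problem: the infimum of the expected cost over all couplings for
which it is defined. -/
def transportValue (c : X × Y → EReal) (P : Measure X) (Q : Measure Y) : EReal :=
  ⨅ (R : Measure (X × Y)) (_ : IsCoupling P Q R ∧ HasExpectation R c), expectation R c

/-- `R` solves the transport problem with cost `c` and marginals `P`, `Q`. -/
structure IsOptimalCoupling (c : X × Y → EReal) (P : Measure X) (Q : Measure Y)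
    (R : Measure (X × Y)) : Prop where
  isCoupling : IsCoupling P Q R
  hasExpectation : HasExpectation R c
  expectation_eq : expectation R c = transportValue c P Q

end Transport

/-! ### The cost function -/

/-- The space `[-∞, ∞)ⁿ` with the product topology and its Borel sets. -/
abbrev ExtSpace (n : ℕ) : Type := Fin n → Set.Iio (⊤ : EReal)

/-- `e ^ x` for `x ∈ [-∞, ∞)`, with `e ^ (-∞) = 0`. -/
def expReal (x : Set.Iio (⊤ : EReal)) : ℝ := (EReal.exp x.1).toReal

/-- `E_μ[e ^ h] = ∑ i, e ^ (h i) * μ i`. -/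
def expMean {n : ℕ} (μ : Fin n → ℝ) (h : ExtSpace n) : ℝ := ∑ i, expReal (h i) * μ i

/-- The cost `c(μ, h) = log (∑ i, e ^ (h i) * μ i) ∈ [-∞, ∞)`. -/
def cost {n : ℕ} (z : ClosedSimplex n × ExtSpace n) : EReal :=
  ENNReal.log (ENNReal.ofReal (expMean z.1.1 z.2))

/-- The vector `h` with `h i = log (π i (μ) / μ i) ∈ [-∞, ∞)`. -/
def logRatio {n : ℕ} (π : Portfolio n) (μ : openSimplex n) : ExtSpace n := fun i =>
  ⟨ENNReal.log (ENNReal.ofReal ((π μ).1 i / μ.1 i)), by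
    rw [Set.mem_Iio, lt_top_iff_ne_top, Ne, ENNReal.log_eq_top_iff]
    exact ENNReal.ofReal_ne_top⟩

end PseudoArbitrage

end

noncomputable section

namespace PseudoArbitrage

open Topology

/-! ### Couplings, expectations and cyclical monotonicity of the support -/

section Transport

variable {X Y : Type*} [MeasurableSpace X] [MeasurableSpace Y]

/-! If `h` determines the portfolio at `p`, the one-step factor from `p` to `q` is `expMean q h /
expMean p h`, so its logarithm is a difference of costs with the same `h`. Around a cycle, the log
relative value is thus the change in total cost when each `h` is matched with the next point instead
of its own. Optimality forbids a decrease on the support (`IsOptimalCoupling.sum_le_sum_perm`), so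
every cycle has relative value at least 1 (`IsOptimalCoupling.isMulCyclicallyMonotone`). As in
Rockafellar's theorem, the infimum `chainInf` of relative values over chains from a fixed point is
then positive; it is concave as an infimum of functions linear in the endpoint, and it generates the
portfolio.

For a generating `Φ`, `Generates.le_mul_growth` telescopes to `Φ (μ t) ≤ Φ (μ 0) * V t`, which
bounds `V` below. If no round trip between two points gains, `Φ` is affine; otherwise repeating one
such trip sends `V` to infinity.

Conversely, a lower bound on `V` makes the infimum over chains with free starting point in `K`,
together with its conjugate `Ψ h = inf_q expMean q h / Φ q`, a pair of multiplicative dual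
potentials (`exists_dual_potentials`). Their product is 1 along the graph of `logRatio π`, where the
cost is 0. After taking logarithms, weak duality gives 0 as a lower bound for all couplings. -/

theorem expectation_coe {R : Measure (X × Y)} {f : X × Y → ℝ} (hf : Integrable f R) :
    expectation R (fun z => (f z : EReal)) = ((∫ z, f z ∂ R : ℝ) : EReal) := by
  have h1 : ∫⁻ z, ENNReal.ofReal (f z) ∂ R ≠ ⊤ := hf.lintegral_lt_top.ne
  have h2 : ∫⁻ z, ENNReal.ofReal (-f z) ∂ R ≠ ⊤ := hf.neg.lintegral_lt_top.ne
  rw [integral_eq_lintegral_pos_part_sub_lintegral_neg_part hf, EReal.coe_sub,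
    EReal.coe_ennreal_toReal h1, EReal.coe_ennreal_toReal h2]
  simp only [expectation, ← EReal.coe_neg, EReal.real_coe_toENNReal]

/-- Subtraction in `EReal` is monotone even at infinite values, so neither expectation has to be
well defined. -/
theorem expectation_mono {R : Measure (X × Y)} {c d : X × Y → EReal} (h : ∀ᵐ z ∂ R, c z ≤ d z) :
    expectation R c ≤ expectation R d := by
  refine EReal.sub_le_sub ?_ ?_
  · exact EReal.coe_ennreal_le_coe_ennreal_iff.2
      (lintegral_mono_ae (h.mono fun z hz => EReal.toENNReal_le_toENNReal hz))
  · exact EReal.coe_ennreal_le_coe_ennreal_iff.2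
      (lintegral_mono_ae (h.mono fun z hz =>
        EReal.toENNReal_le_toENNReal (EReal.neg_le_neg_iff.2 hz)))

theorem lintegral_ne_top_of_expectation_ne {R : Measure (X × Y)} {c : X × Y → EReal}
    (h : HasExpectation R c) (ht : expectation R c ≠ ⊤) (hb : expectation R c ≠ ⊥) :
    ∫⁻ z, (c z).toENNReal ∂ R ≠ ⊤ ∧ ∫⁻ z, (-c z).toENNReal ∂ R ≠ ⊤ := by
  unfold expectation at ht hb
  unfold HasExpectation at h
  generalize ∫⁻ z, (c z).toENNReal ∂ R = p at h ht hb ⊢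
  generalize ∫⁻ z, (-c z).toENNReal ∂ R = q at h ht hb ⊢
  induction p with
  | top =>
    induction q with
    | top => simp at h
    | coe q => exact absurd rfl ht
  | coe p =>
    induction q with
    | top => exact absurd rfl hb
    | coe q => simp

/-- Replacing the piece `ν` of `R` by `ν'` leaves both marginals unchanged, so `R - ν + ν'` competes
with `R`. Finiteness of the value makes the contribution of `R - ν` finite, and it cancels. -/
theorem IsOptimalCoupling.integral_le_of_swap {c : X × Y → EReal} {P : Measure X} {Q : Measure Y}
    {R : Measure (X × Y)} (hR : IsOptimalCoupling c P Q R)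
    (ht : transportValue c P Q ≠ ⊤) (hb : transportValue c P Q ≠ ⊥)
    {ν ν' : Measure (X × Y)} [IsFiniteMeasure ν] (hν : ν ≤ R)
    (hfst : ν.map Prod.fst = ν'.map Prod.fst) (hsnd : ν.map Prod.snd = ν'.map Prod.snd)
    {f : X × Y → ℝ} (hf : Integrable f ν) (hf' : Integrable f ν')
    (hc : ∀ᵐ z ∂ν, c z = f z) (hc' : ∀ᵐ z ∂ν', c z = f z) :
    ∫ z, f z ∂ν ≤ ∫ z, f z ∂ν' := by
  have hadd : R - ν + ν = R := Measure.sub_add_cancel_of_le hν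
  set R₀ := R - ν
  have := hR.isCoupling.isProbability
  have hcoup : IsCoupling P Q (R₀ + ν') := by
    have h1 : (R₀ + ν').map Prod.fst = P := by
      rw [Measure.map_add _ _ measurable_fst, ← hfst, ← Measure.map_add _ _ measurable_fst, hadd,
        hR.isCoupling.fst_eq]
    refine ⟨⟨?_⟩, h1, ?_⟩
    · have h2 : R.map Prod.fst Set.univ = (R₀ + ν').map Prod.fst Set.univ := by
        rw [h1, hR.isCoupling.fst_eq]
      rw [Measure.map_apply measurable_fst .univ, Measure.map_apply measurable_fst .univ,
        Set.preimage_univ, measure_univ] at h2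
      exact h2.symm
    · rw [Measure.map_add _ _ measurable_snd, ← hsnd, ← Measure.map_add _ _ measurable_snd, hadd,
        hR.isCoupling.snd_eq]
  obtain ⟨hp, hq⟩ := lintegral_ne_top_of_expectation_ne hR.hasExpectation
    (hR.expectation_eq ▸ ht) (hR.expectation_eq ▸ hb)
  have key : ∀ (m : Measure (X × Y)), Integrable f m → (∀ᵐ z ∂m, c z = f z) →
      ∫⁻ z, (c z).toENNReal ∂m ≠ ⊤ ∧ ∫⁻ z, (-c z).toENNReal ∂m ≠ ⊤ ∧
      ∫ z, f z ∂m = (∫⁻ z, (c z).toENNReal ∂m).toReal - (∫⁻ z, (-c z).toENNReal ∂m).toReal := by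
    intro m hfm hcm
    have e1 : ∫⁻ z, (c z).toENNReal ∂m = ∫⁻ z, ENNReal.ofReal (f z) ∂m :=
      lintegral_congr_ae (hcm.mono fun z hz => by simp only [hz, EReal.real_coe_toENNReal])
    have e2 : ∫⁻ z, (-c z).toENNReal ∂m = ∫⁻ z, ENNReal.ofReal (-f z) ∂m :=
      lintegral_congr_ae (hcm.mono fun z hz => by
        simp only [hz, ← EReal.coe_neg, EReal.real_coe_toENNReal])
    rw [e1, e2]
    exact ⟨hfm.lintegral_lt_top.ne, hfm.neg.lintegral_lt_top.ne,
      integral_eq_lintegral_pos_part_sub_lintegral_neg_part hfm⟩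
  obtain ⟨hpν, hqν, hν_eq⟩ := key ν hf hc
  obtain ⟨hpν', hqν', hν'_eq⟩ := key ν' hf' hc'
  rw [← hadd, lintegral_add_measure] at hp hq
  have hp0 := (ENNReal.add_ne_top.1 hp).1
  have hq0 := (ENNReal.add_ne_top.1 hq).1
  have hexp' : HasExpectation (R₀ + ν') c := by
    left
    rw [lintegral_add_measure]
    exact ENNReal.add_ne_top.2 ⟨hp0, hpν'⟩
  have hle : expectation R c ≤ expectation (R₀ + ν') c := by
    rw [hR.expectation_eq]
    exact iInf₂_le _ ⟨hcoup, hexp'⟩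
  rw [← hadd] at hle
  unfold expectation at hle
  simp only [lintegral_add_measure] at hle
  rw [hν_eq, hν'_eq]
  lift (∫⁻ z, (c z).toENNReal ∂ R₀) to NNReal using hp0 with p0
  lift (∫⁻ z, (-c z).toENNReal ∂ R₀) to NNReal using hq0 with q0
  lift (∫⁻ z, (c z).toENNReal ∂ν) to NNReal using hpν with p1
  lift (∫⁻ z, (-c z).toENNReal ∂ν) to NNReal using hqν with q1
  lift (∫⁻ z, (c z).toENNReal ∂ν') to NNReal using hpν' with p2
  lift (∫⁻ z, (-c z).toENNReal ∂ν') to NNReal using hqν' with q2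
  have hle' : ((p0 + p1 - (q0 + q1) : ℝ) : EReal) ≤ ((p0 + p2 - (q0 + q2) : ℝ) : EReal) := by
    simp only [EReal.coe_ennreal_add, EReal.coe_nnreal_eq_coe_real] at hle
    exact_mod_cast hle
  have := EReal.coe_le_coe_iff.1 hle'
  simp only [ENNReal.coe_toReal]
  linarith

/-- The support of an optimal coupling with finite value is cyclically monotone at points where the
cost is finite and continuous. -/
theorem IsOptimalCoupling.sum_le_sum_perm [TopologicalSpace X] [OpensMeasurableSpace X]
    [TopologicalSpace Y] [OpensMeasurableSpace Y] {c : X × Y → EReal} (hcm : Measurable c)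
    {P : Measure X} {Q : Measure Y} {R : Measure (X × Y)} (hR : IsOptimalCoupling c P Q R)
    (ht : transportValue c P Q ≠ ⊤) (hb : transportValue c P Q ≠ ⊥)
    {ι : Type*} [Fintype ι] (σ : Equiv.Perm ι) {x : ι → X} {y : ι → Y}
    (hsupp : ∀ i, (x i, y i) ∈ R.support) {a b : ι → ℝ}
    (ha : ∀ i, Tendsto c (𝓝 (x i, y i)) (𝓝 (a i)))
    (hb' : ∀ i, Tendsto c (𝓝 (x (σ i), y i)) (𝓝 (b i))) :
    ∑ i, a i ≤ ∑ i, b i := by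
  have := hR.isCoupling.isProbability
  refine le_of_forall_pos_le_add fun η hη => ?_
  -- Both sums will be off by at most `δ` per index; the `+ 1` keeps the denominator positive when
  -- `ι` is empty.
  obtain ⟨δ, hδ, hδη⟩ : ∃ δ > 0, (2 * Fintype.card ι : ℝ) * δ ≤ η :=
    ⟨η / (2 * Fintype.card ι + 1), by positivity, by
      rw [mul_div_assoc', div_le_iff₀ (by positivity)]; nlinarith⟩
  have nhd : ∀ (z : X × Y) (r : ℝ), Tendsto c (𝓝 z) (𝓝 (r : EReal)) →
      ∃ (V : Set X) (W : Set Y), IsOpen V ∧ z.1 ∈ V ∧ IsOpen W ∧ z.2 ∈ W ∧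
        ∀ v ∈ V, ∀ w ∈ W, ∃ s : ℝ, c (v, w) = s ∧ r - δ ≤ s ∧ s ≤ r + δ := by
    intro z r h
    have hmem : Set.Ioo ((r - δ : ℝ) : EReal) ((r + δ : ℝ) : EReal) ∈ 𝓝 (r : EReal) :=
      Ioo_mem_nhds (EReal.coe_lt_coe_iff.2 (by linarith)) (EReal.coe_lt_coe_iff.2 (by linarith))
    obtain ⟨V, W, hV, hzV, hW, hzW, hVW⟩ := mem_nhds_prod_iff'.1 (h hmem)
    refine ⟨V, W, hV, hzV, hW, hzW, fun v hv w hw => ?_⟩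
    have hvw : c (v, w) ∈ Set.Ioo _ _ := hVW (Set.mk_mem_prod hv hw)
    generalize c (v, w) = e at hvw
    induction e with
    | bot => exact absurd hvw.1 not_lt_bot
    | top => exact absurd hvw.2 not_top_lt
    | coe s =>
      exact ⟨s, rfl, (EReal.coe_lt_coe_iff.1 hvw.1).le, (EReal.coe_lt_coe_iff.1 hvw.2).le⟩
  choose V₁ W₁ hV₁ hxV₁ hW₁ hyW₁ h₁ using fun i => nhd _ _ (ha i)
  choose V₂ W₂ hV₂ hxV₂ hW₂ hyW₂ h₂ using fun i => nhd _ _ (hb' i)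
  -- The point `x i` occurs in the original pair with index `i` and in the permuted pair with index
  -- `σ.symm i`.
  let V : ι → Set X := fun i => V₁ i ∩ V₂ (σ.symm i)
  let W : ι → Set Y := fun i => W₁ i ∩ W₂ i
  have hVo : ∀ i, IsOpen (V i) := fun i => (hV₁ i).inter (hV₂ _)
  have hWo : ∀ i, IsOpen (W i) := fun i => (hW₁ i).inter (hW₂ _)
  have hxV : ∀ i, x i ∈ V i := fun i => ⟨hxV₁ i, by simpa using hxV₂ (σ.symm i)⟩
  have hyW : ∀ i, y i ∈ W i := fun i => ⟨hyW₁ i, hyW₂ i⟩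
  let U : ι → Set (X × Y) := fun i => V i ×ˢ W i
  have hU : ∀ i, MeasurableSet (U i) := fun i =>
    (hVo i).measurableSet.prod (hWo i).measurableSet
  have hUpos : ∀ i, R (U i) ≠ 0 := fun i =>
    ((Measure.mem_support_iff_forall _).1 (hsupp i) _
      (prod_mem_nhds ((hVo i).mem_nhds (hxV i)) ((hWo i).mem_nhds (hyW i)))).ne'
  let ρ : ι → Measure (X × Y) := fun i => (R (U i))⁻¹ • R.restrict (U i)
  have hρ : ∀ i, IsProbabilityMeasure (ρ i) := fun i => ⟨by
    simp [ρ, ENNReal.inv_mul_cancel (hUpos i) (measure_ne_top R _)]⟩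
  have hρU : ∀ i, ∀ᵐ z ∂(ρ i), z ∈ U i := fun i =>
    Measure.ae_smul_measure (ae_restrict_mem (hU i)) _
  -- Near `(x (σ i), y i)` the exchanged mass is the product of the marginals of the localized
  -- pieces `ρ (σ i)` and `ρ i`.
  let ρ' : ι → Measure (X × Y) := fun i =>
    ((ρ (σ i)).map Prod.fst).prod ((ρ i).map Prod.snd)
  have hρf : ∀ i, IsProbabilityMeasure ((ρ i).map Prod.fst) := fun i =>
    Measure.isProbabilityMeasure_map measurable_fst.aemeasurable
  have hρs : ∀ i, IsProbabilityMeasure ((ρ i).map Prod.snd) := fun i =>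
    Measure.isProbabilityMeasure_map measurable_snd.aemeasurable
  have hρ' : ∀ i, IsProbabilityMeasure (ρ' i) := fun i => by
    dsimp only [ρ']; infer_instance
  have hρ'U : ∀ i, ∀ᵐ z ∂(ρ' i), z ∈ V (σ i) ×ˢ W i := by
    intro i
    have hf : ∀ᵐ v ∂((ρ (σ i)).map Prod.fst), v ∈ V (σ i) :=
      (ae_map_iff measurable_fst.aemeasurable (hVo _).measurableSet).2
        ((hρU (σ i)).mono fun z hz => hz.1)
    have hs : ∀ᵐ w ∂((ρ i).map Prod.snd), w ∈ W i :=
      (ae_map_iff measurable_snd.aemeasurable (hWo _).measurableSet).2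
        ((hρU i).mono fun z hz => hz.2)
    have hf' := Measure.quasiMeasurePreserving_fst (μ := (ρ (σ i)).map Prod.fst)
      (ν := (ρ i).map Prod.snd) |>.ae hf
    have hs' := Measure.quasiMeasurePreserving_snd (μ := (ρ (σ i)).map Prod.fst)
      (ν := (ρ i).map Prod.snd) |>.ae hs
    filter_upwards [hf', hs'] with z h1 h2 using ⟨h1, h2⟩
  let f : X × Y → ℝ := fun z => (c z).toReal
  have hfm : Measurable f := measurable_ereal_toReal.comp hcm
  have hcρ : ∀ i, ∀ᵐ z ∂(ρ i), c z = f z ∧ a i - δ ≤ f z ∧ f z ≤ a i + δ := fun i =>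
    (hρU i).mono fun z hz => by
      obtain ⟨s, hs, hs'⟩ := h₁ i z.1 hz.1.1 z.2 hz.2.1
      have : f z = s := by simp only [f, hs, EReal.toReal_coe]
      exact ⟨this ▸ hs, this ▸ hs'⟩
  have hcρ' : ∀ i, ∀ᵐ z ∂(ρ' i), c z = f z ∧ b i - δ ≤ f z ∧ f z ≤ b i + δ := fun i =>
    (hρ'U i).mono fun z hz => by
      obtain ⟨s, hs, hs'⟩ := h₂ i z.1 (by simpa using hz.1.2) z.2 hz.2.2
      have : f z = s := by simp only [f, hs, EReal.toReal_coe]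
      exact ⟨this ▸ hs, this ▸ hs'⟩
  have hint : ∀ (m : Measure (X × Y)) [IsProbabilityMeasure m] (r : ℝ),
      (∀ᵐ z ∂m, c z = f z ∧ r - δ ≤ f z ∧ f z ≤ r + δ) → Integrable f m := fun m _ r h =>
    Integrable.of_mem_Icc (r - δ) (r + δ) hfm.aemeasurable (h.mono fun z hz => hz.2)
  have hi := fun i => hint _ _ (hcρ i)
  have hi' := fun i => hint _ _ (hcρ' i)
  -- Since `∏ j, R (U j) ≤ R (U i)`, the product times `ρ i` is at most `R` for every `i`; averaging
  -- over `ι` then keeps the sum below `R` even if the `U i` overlap.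
  let κ : ENNReal := (Fintype.card ι : ENNReal)⁻¹ * ∏ i, R (U i)
  rcases isEmpty_or_nonempty ι with hι | hι
  · simpa using hη.le
  have hκ0 : κ ≠ 0 := mul_ne_zero (by simp) (Finset.prod_ne_zero_iff.2 fun i _ => hUpos i)
  have hκt : κ ≠ ⊤ := ENNReal.mul_ne_top (by simp) (ENNReal.prod_ne_top fun i _ =>
    measure_ne_top R _)
  have hνR : κ • ∑ i, ρ i ≤ R := by
    refine Measure.le_iff.2 fun s hs => ?_
    have hterm : ∀ i, (∏ j, R (U j)) * ρ i s ≤ R s := by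
      intro i
      have h1 : ∏ j, R (U j) ≤ R (U i) := by
        classical
        rw [← Finset.mul_prod_erase _ _ (Finset.mem_univ i)]
        exact mul_le_of_le_one_right' (Finset.prod_le_one' fun j _ => prob_le_one)
      calc (∏ j, R (U j)) * ρ i s ≤ R (U i) * ((R (U i))⁻¹ * R.restrict (U i) s) := by
            gcongr
            simp [ρ]
        _ = R.restrict (U i) s := by
            rw [← mul_assoc, ENNReal.mul_inv_cancel (hUpos i) (measure_ne_top R _), one_mul]
        _ ≤ R s := Measure.restrict_apply_le _ _
    calc (κ • ∑ i, ρ i) s = (Fintype.card ι : ENNReal)⁻¹ * ∑ i, (∏ j, R (U j)) * ρ i s := by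
          simp [κ, Finset.mul_sum, mul_assoc]
      _ ≤ (Fintype.card ι : ENNReal)⁻¹ * ∑ _i : ι, R s := by
          gcongr with i; exact hterm i
      _ = R s := by
          rw [Finset.sum_const, Finset.card_univ, nsmul_eq_mul, ← mul_assoc,
            ENNReal.inv_mul_cancel (by simp) (by simp), one_mul]
  have hfst : (κ • ∑ i, ρ i).map Prod.fst = (κ • ∑ i, ρ' i).map Prod.fst := by
    ext s hs
    simp only [Measure.map_apply measurable_fst hs, Measure.smul_apply, Measure.finsetSum_apply]
    congr 1
    rw [← Equiv.sum_comp σ]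
    refine Finset.sum_congr rfl fun i _ => ?_
    rw [← Measure.map_apply measurable_fst hs, ← Measure.map_apply measurable_fst hs,
      Measure.map_fst_prod, measure_univ, one_smul]
  have hsnd : (κ • ∑ i, ρ i).map Prod.snd = (κ • ∑ i, ρ' i).map Prod.snd := by
    ext s hs
    simp only [Measure.map_apply measurable_snd hs, Measure.smul_apply, Measure.finsetSum_apply]
    congr 1
    refine Finset.sum_congr rfl fun i _ => ?_
    rw [← Measure.map_apply measurable_snd hs, ← Measure.map_apply measurable_snd hs,
      Measure.map_snd_prod, measure_univ, one_smul]
  have hfin : IsFiniteMeasure (κ • ∑ i, ρ i) := isFiniteMeasure_of_le R hνR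
  have hae : ∀ (m : ι → Measure (X × Y)), (∀ i, ∀ᵐ z ∂(m i), c z = f z) →
      ∀ᵐ z ∂(κ • ∑ i, m i), c z = f z := by
    intro m hm
    refine Measure.ae_smul_measure ?_ κ
    rw [ae_iff, Measure.finsetSum_apply]
    exact Finset.sum_eq_zero fun i _ => ae_iff.1 (hm i)
  have hle := hR.integral_le_of_swap ht hb hνR hfst hsnd
    ((integrable_finsetSum_measure.2 fun i _ => hi i).smul_measure hκt)
    ((integrable_finsetSum_measure.2 fun i _ => hi' i).smul_measure hκt)
    (hae _ fun i => (hcρ i).mono fun z hz => hz.1) (hae _ fun i => (hcρ' i).mono fun z hz => hz.1)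
  rw [integral_smul_measure, integral_smul_measure, integral_finsetSum_measure fun i _ => hi i,
    integral_finsetSum_measure fun i _ => hi' i, smul_eq_mul, smul_eq_mul] at hle
  have hle' := le_of_mul_le_mul_left hle (ENNReal.toReal_pos hκ0 hκt)
  have hlow : ∀ i, a i - δ ≤ ∫ z, f z ∂(ρ i) := fun i => by
    simpa using integral_mono_ae (integrable_const (a i - δ)) (hi i)
      ((hcρ i).mono fun z hz => hz.2.1)
  have hupp : ∀ i, ∫ z, f z ∂(ρ' i) ≤ b i + δ := fun i => by
    simpa using integral_mono_ae (hi' i) (integrable_const (b i + δ))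
      ((hcρ' i).mono fun z hz => hz.2.2)
  have hfinal := (Finset.sum_le_sum fun i _ => hlow i).trans
    (hle'.trans (Finset.sum_le_sum fun i (_ : i ∈ Finset.univ) => hupp i))
  rw [Finset.sum_sub_distrib, Finset.sum_add_distrib, Finset.sum_const, Finset.card_univ,
    nsmul_eq_mul] at hfinal
  linarith

end Transport

/-! ### Growth factors and relative values along a path -/

variable {n : ℕ}

/-- The one-period relative growth of the portfolio `π` when the market moves from `p` to `q`. -/
def growth (π : Portfolio n) (p : openSimplex n) (q : Fin n → ℝ) : ℝ :=
  ∑ i, (π p).1 i * (q i / p.1 i)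

theorem relativeValue_succ (π : Portfolio n) (μ : ℕ → openSimplex n) (t : ℕ) :
    relativeValue π μ (t + 1) = relativeValue π μ t * growth π (μ t) (μ (t + 1)).1 := rfl

theorem growth_nonneg (π : Portfolio n) (p : openSimplex n) {q : Fin n → ℝ} (hq : ∀ i, 0 ≤ q i) :
    0 ≤ growth π p q :=
  Finset.sum_nonneg fun i _ => mul_nonneg ((π p).2.1 i) (div_nonneg (hq i) (p.2.1 i).le)

theorem growth_self (π : Portfolio n) (p : openSimplex n) : growth π p p.1 = 1 := by
  rw [← (π p).2.2]
  exact Finset.sum_congr rfl fun i _ => by rw [div_self (p.2.1 i).ne', mul_one]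

theorem growth_mono (π : Portfolio n) (p : openSimplex n) {q r : Fin n → ℝ} (h : ∀ i, q i ≤ r i) :
    growth π p q ≤ growth π p r :=
  Finset.sum_le_sum fun i _ => mul_le_mul_of_nonneg_left
    (div_le_div_of_nonneg_right (h i) (p.2.1 i).le) ((π p).2.1 i)

theorem growth_add (π : Portfolio n) (p : openSimplex n) (q r : Fin n → ℝ) :
    growth π p (q + r) = growth π p q + growth π p r := by
  simp only [growth, ← Finset.sum_add_distrib]
  exact Finset.sum_congr rfl fun i _ => by rw [Pi.add_apply]; ring

theorem growth_smul (π : Portfolio n) (p : openSimplex n) (a : ℝ) (q : Fin n → ℝ) :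
    growth π p (a • q) = a * growth π p q := by
  simp only [growth, Finset.mul_sum]
  exact Finset.sum_congr rfl fun i _ => by rw [Pi.smul_apply, smul_eq_mul]; ring

theorem continuous_growth (π : Portfolio n) (p : openSimplex n) : Continuous (growth π p) := by
  unfold growth
  fun_prop

theorem growth_pos {π : Portfolio n} {p : openSimplex n} (hp : ∀ i, 0 < (π p).1 i)
    (q : openSimplex n) : 0 < growth π p q.1 := by
  have hn : (Finset.univ : Finset (Fin n)).Nonempty := by
    by_contra h
    have := q.2.2
    rw [Finset.not_nonempty_iff_eq_empty.1 h] at this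
    simp at this
  exact Finset.sum_pos (fun i _ => mul_pos (hp i) (div_pos (q.2.1 i) (p.2.1 i))) hn

theorem relativeValue_nonneg (π : Portfolio n) (μ : ℕ → openSimplex n) (t : ℕ) :
    0 ≤ relativeValue π μ t := by
  induction t with
  | zero => exact zero_le_one
  | succ t ih => exact mul_nonneg ih (growth_nonneg _ _ fun i => ((μ (t + 1)).2.1 i).le)

theorem relativeValue_congr (π : Portfolio n) {μ ν : ℕ → openSimplex n} {t : ℕ}
    (h : ∀ s ≤ t, μ s = ν s) : relativeValue π μ t = relativeValue π ν t := by
  induction t with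
  | zero => rfl
  | succ t ih =>
    rw [relativeValue_succ, relativeValue_succ, ih fun s hs => h s (hs.trans t.le_succ),
      h t t.le_succ, h (t + 1) le_rfl]

theorem relativeValue_eq_prod (π : Portfolio n) (μ : ℕ → openSimplex n) (t : ℕ) :
    relativeValue π μ t = ∏ s ∈ Finset.range t, growth π (μ s) (μ (s + 1)).1 := by
  induction t with
  | zero => rfl
  | succ t ih => rw [relativeValue_succ, Finset.prod_range_succ, ih]

/-! ### Infima over chains and functional generation -/

theorem exists_relativeValue_extend (π : Portfolio n) {K : Set (openSimplex n)}
    {μ : ℕ → openSimplex n} (hμ : ∀ t, μ t ∈ K) (m : ℕ) {q : openSimplex n} (hq : q ∈ K) :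
    ∃ ν : ℕ → openSimplex n, (∀ t, ν t ∈ K) ∧ ν 0 = μ 0 ∧ ν (m + 1) = q ∧
      relativeValue π ν (m + 1) = relativeValue π μ m * growth π (μ m) q.1 := by
  refine ⟨fun t => if t ≤ m then μ t else q, fun t => ?_, by simp, by simp, ?_⟩
  · dsimp only
    split_ifs
    exacts [hμ t, hq]
  · rw [relativeValue_succ, relativeValue_congr π (ν := μ) fun s hs => if_pos hs]
    simp

/-- Sequences in `K` starting in `S`, stopped at some time. -/
abbrev StoppedPath (K S : Set (openSimplex n)) : Type :=
  {μ : ℕ → openSimplex n // (∀ t, μ t ∈ K) ∧ μ 0 ∈ S} × ℕ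

/-- The infimum of the relative values at `q` over all chains in `K` that start in `S` and end
at `q`. -/
def chainInf (π : Portfolio n) (K S : Set (openSimplex n)) (q : Fin n → ℝ) : ℝ :=
  ⨅ x : StoppedPath K S, relativeValue π x.1.1 x.2 * growth π (x.1.1 x.2) q

theorem chain_nonneg (π : Portfolio n) {K S : Set (openSimplex n)} {q : Fin n → ℝ}
    (hq : ∀ i, 0 ≤ q i) (x : StoppedPath K S) :
    0 ≤ relativeValue π x.1.1 x.2 * growth π (x.1.1 x.2) q :=
  mul_nonneg (relativeValue_nonneg _ _ _) (growth_nonneg _ _ hq)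

theorem chainInf_le (π : Portfolio n) {K S : Set (openSimplex n)} {q : Fin n → ℝ}
    (hq : ∀ i, 0 ≤ q i) (x : StoppedPath K S) :
    chainInf π K S q ≤ relativeValue π x.1.1 x.2 * growth π (x.1.1 x.2) q :=
  ciInf_le ⟨0, Set.forall_mem_range.2 fun x => chain_nonneg π hq x⟩ x

theorem chainInf_le_growth (π : Portfolio n) {K S : Set (openSimplex n)} {p : openSimplex n}
    (hp : p ∈ K) (hpS : p ∈ S) {q : Fin n → ℝ} (hq : ∀ i, 0 ≤ q i) :
    chainInf π K S q ≤ growth π p q := by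
  simpa [relativeValue] using
    chainInf_le π hq (K := K) (S := S) (⟨fun _ => p, fun _ => hp, hpS⟩, 0)

/-- A chain ending at `p ∈ K` can be continued by one step to `q`. -/
theorem chainInf_le_mul_growth (π : Portfolio n) {K S : Set (openSimplex n)} {p : openSimplex n}
    (hp : p ∈ K) {q : Fin n → ℝ} (hq : ∀ i, 0 ≤ q i) :
    chainInf π K S q ≤ chainInf π K S p.1 * growth π p q := by
  rw [chainInf, chainInf, Real.iInf_mul_of_nonneg (growth_nonneg π p hq)]
  rcases isEmpty_or_nonempty (StoppedPath K S) with h | h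
  · simp [Real.iInf_of_isEmpty]
  refine le_ciInf fun x => ?_
  obtain ⟨ν, hν, hν0, hνm, hval⟩ := exists_relativeValue_extend π x.1.2.1 x.2 hp
  have := chainInf_le π hq (K := K) (S := S) (⟨ν, hν, hν0 ▸ x.1.2.2⟩, x.2 + 1)
  simp only [hval, hνm] at this
  exact this

theorem convex_openSimplex (n : ℕ) : Convex ℝ (openSimplex n) := by
  intro x hx y hy a b ha hb hab
  refine ⟨fun i => ?_, ?_⟩
  · rcases ha.eq_or_lt with rfl | ha
    · have : b = 1 := by linarith
      simpa [this] using hy.1 i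
    · exact add_pos_of_pos_of_nonneg (mul_pos ha (hx.1 i)) (mul_nonneg hb (hy.1 i).le)
  · simp [Finset.sum_add_distrib, ← Finset.mul_sum, hx.2, hy.2, hab]

theorem concaveOn_chainInf (π : Portfolio n) {K S : Set (openSimplex n)}
    [Nonempty (StoppedPath K S)] : ConcaveOn ℝ (openSimplex n) (chainInf π K S) := by
  refine ⟨convex_openSimplex n, fun p hp q hq a b ha hb _ => le_ciInf fun x => ?_⟩
  have h1 := mul_le_mul_of_nonneg_left (chainInf_le π (fun i => (hp.1 i).le) x) ha
  have h2 := mul_le_mul_of_nonneg_left (chainInf_le π (fun i => (hq.1 i).le) x) hb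
  rw [growth_add, growth_smul, growth_smul, smul_eq_mul, smul_eq_mul]
  linarith

theorem sum_tangentRatio [NeZero n] (π : Portfolio n) (p : openSimplex n) :
    ∑ i, tangentRatio π p i = 0 := by
  have : (n : ℝ) ≠ 0 := Nat.cast_ne_zero.2 (NeZero.ne n)
  simp only [tangentRatio, Finset.sum_sub_distrib, Finset.sum_const, Finset.card_univ,
    Fintype.card_fin, nsmul_eq_mul]
  field_simp
  ring

/-- The mean subtracted in `tangentRatio` pairs to zero with `q - p`, whose coordinates sum to zero.
-/
theorem sum_tangentRatio_mul (π : Portfolio n) (p q : openSimplex n) :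
    ∑ i, tangentRatio π p i * (q.1 i - p.1 i) = growth π p q.1 - 1 := by
  have h : ∑ i, (q.1 i - p.1 i) = 0 := by rw [Finset.sum_sub_distrib, q.2.2, p.2.2, sub_self]
  simp only [tangentRatio, sub_mul, Finset.sum_sub_distrib (f := fun i => _ / _ * _),
    ← Finset.mul_sum, h, mul_zero, sub_zero]
  rw [← growth_self π p, growth, growth, ← Finset.sum_sub_distrib]
  exact Finset.sum_congr rfl fun i _ => by ring

theorem neZero_of_openSimplex (p : openSimplex n) : NeZero n := by
  refine ⟨?_⟩
  rintro rfl
  simpa using p.2.2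

/-- Multiplicative cyclical monotonicity of a portfolio on `K`. -/
def IsMulCyclicallyMonotone (K : Set (openSimplex n)) (π : Portfolio n) : Prop :=
  ∀ μ : ℕ → openSimplex n, (∀ t, μ t ∈ K) → ∀ m, μ m = μ 0 → 1 ≤ relativeValue π μ m

/-- Closing a chain back at `p₀` yields value at least 1. With `c` below all `q i`, one has `c • p₀
≤ q` coordinatewise, so ending at `q` instead costs at most the factor `c`. -/
theorem IsMulCyclicallyMonotone.chainInf_pos {K : Set (openSimplex n)} {π : Portfolio n}
    (h : IsMulCyclicallyMonotone K π) {p₀ : openSimplex n} (hp₀ : p₀ ∈ K) {q : Fin n → ℝ}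
    (hq : ∀ i, 0 < q i) : 0 < chainInf π K {p₀} q := by
  obtain ⟨c, hcq, hc⟩ : ∃ c : ℝ, (∀ i, c ≤ q i) ∧ 0 < c := by
    have h1 : ∀ᶠ c : ℝ in 𝓝[>] 0, ∀ i, c ≤ q i := eventually_all.2 fun i =>
      nhdsWithin_le_nhds (eventually_le_nhds (hq i))
    exact (h1.and self_mem_nhdsWithin).exists
  have : Nonempty (StoppedPath K {p₀}) := ⟨⟨fun _ => p₀, fun _ => hp₀, rfl⟩, 0⟩
  refine hc.trans_le (le_ciInf fun x => ?_)
  obtain ⟨ν, hν, hν0, hνm, hval⟩ := exists_relativeValue_extend π x.1.2.1 x.2 hp₀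
  have h1 : 1 ≤ relativeValue π ν (x.2 + 1) := h ν hν _ (by rw [hνm, hν0]; exact x.1.2.2.symm)
  rw [hval] at h1
  have h2 : c * growth π (x.1.1 x.2) p₀.1 ≤ growth π (x.1.1 x.2) q := by
    rw [← growth_smul]
    refine growth_mono _ _ fun i => ?_
    have : p₀.1 i ≤ 1 := p₀.2.2 ▸
      Finset.single_le_sum (f := p₀.1) (fun j _ => (p₀.2.1 j).le) (Finset.mem_univ i)
    exact (mul_le_of_le_one_right hc.le this).trans (hcq i)
  calc c ≤ c * (relativeValue π x.1.1 x.2 * growth π (x.1.1 x.2) p₀.1) :=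
        le_mul_of_one_le_right hc.le h1
    _ = relativeValue π x.1.1 x.2 * (c * growth π (x.1.1 x.2) p₀.1) := by ring
    _ ≤ _ := mul_le_mul_of_nonneg_left h2 (relativeValue_nonneg _ _ _)

/-- A multiplicatively cyclically monotone portfolio is functionally generated. -/
theorem IsMulCyclicallyMonotone.exists_generates {K : Set (openSimplex n)} {π : Portfolio n}
    (h : IsMulCyclicallyMonotone K π) : ∃ Φ : (Fin n → ℝ) → ℝ, Generates Φ K π := by
  rcases K.eq_empty_or_nonempty with rfl | ⟨p₀, hp₀⟩
  · exact ⟨fun _ => 1, concaveOn_const 1 (convex_openSimplex n), fun _ _ => one_pos,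
      fun _ hp => hp.elim⟩
  have : Nonempty (StoppedPath K {p₀}) := ⟨⟨fun _ => p₀, fun _ => hp₀, rfl⟩, 0⟩
  refine ⟨chainInf π K {p₀}, concaveOn_chainInf π, fun p hp => h.chainInf_pos hp₀ hp.1,
    fun p hp => ⟨?_, fun q => ?_⟩⟩
  · have := neZero_of_openSimplex p
    exact sum_tangentRatio π p
  · have hΦp := h.chainInf_pos hp₀ p.2.1
    have hΦq := h.chainInf_pos hp₀ q.2.1
    -- The multiplicative inequality becomes the supergradient inequality through `log x ≤ x - 1`.
    have hle := chainInf_le_mul_growth π (S := {p₀}) hp fun i => (q.2.1 i).le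
    have hg : 0 < growth π p q.1 := pos_of_mul_pos_right (hΦq.trans_le hle) hΦp.le
    rw [sum_tangentRatio_mul]
    calc _ ≤ Real.log (chainInf π K {p₀} p.1 * growth π p q.1) := Real.log_le_log hΦq hle
      _ = Real.log (chainInf π K {p₀} p.1) + Real.log (growth π p q.1) :=
        Real.log_mul hΦp.ne' hg.ne'
      _ ≤ _ := by gcongr; exact Real.log_le_sub_one_of_pos hg

/-! ### Functionally generated portfolios are pseudo-arbitrages -/

/-- This compares slopes at `s = 0`, with `1 - u⁻¹ ≤ log u` in place of a derivative. -/
theorem le_of_forall_log_one_add_mul_le {x y : ℝ} (hx : -1 < x)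
    (h : ∀ s : ℝ, 0 < s → s < 1 → Real.log (1 + s * x) ≤ s * y) : x ≤ y := by
  have key : ∀ᶠ s : ℝ in 𝓝[>] 0, x ≤ y * (1 + s * x) := by
    filter_upwards [Ioo_mem_nhdsGT one_pos] with s hs
    have hpos : 0 < 1 + s * x := by nlinarith [hs.1, hs.2]
    have h1 := (Real.one_sub_inv_le_log_of_pos hpos).trans (h s hs.1 hs.2)
    have h2 : 1 - (1 + s * x)⁻¹ = s * (x / (1 + s * x)) := by field_simp; ring
    rw [h2] at h1
    exact (div_le_iff₀ hpos).1 (le_of_mul_le_mul_left h1 hs.1)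
  have hlim : Tendsto (fun s : ℝ => y * (1 + s * x)) (𝓝[>] 0) (𝓝 y) := by
    have : Continuous fun s : ℝ => y * (1 + s * x) := by fun_prop
    simpa using (this.tendsto 0).mono_left nhdsWithin_le_nhds
  exact ge_of_tendsto hlim key

/-- The supergradient inequality at `q` itself only bounds `log (Φ q / Φ p)` by `growth π p q - 1`.
Applying it at points of the segment near `p`, where concavity puts `Φ` above its chord, and letting
them tend to `p` removes the logarithm. -/
theorem Generates.le_mul_growth {Φ : (Fin n → ℝ) → ℝ} {K : Set (openSimplex n)} {π : Portfolio n}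
    (h : Generates Φ K π) {p : openSimplex n} (hp : p ∈ K) (q : openSimplex n) :
    Φ q.1 ≤ Φ p.1 * growth π p q.1 := by
  have hΦp := h.pos p.1 p.2
  have hΦq := h.pos q.1 q.2
  have key : Φ q.1 / Φ p.1 - 1 ≤ growth π p q.1 - 1 := by
    refine le_of_forall_log_one_add_mul_le (by linarith [div_pos hΦq hΦp]) fun s hs hs1 => ?_
    have hmem : (1 - s) • p.1 + s • q.1 ∈ openSimplex n :=
      convex_openSimplex n p.2 q.2 (by linarith) hs.le (by ring)
    have hsup := (h.supergradient p hp).2 ⟨_, hmem⟩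
    rw [sum_tangentRatio_mul, growth_add, growth_smul, growth_smul, growth_self] at hsup
    have hconc := h.concave.2 p.2 q.2 (by linarith : 0 ≤ 1 - s) hs.le (by ring)
    rw [smul_eq_mul, smul_eq_mul] at hconc
    have heq : (1 - s) * Φ p.1 + s * Φ q.1 = Φ p.1 * (1 + s * (Φ q.1 / Φ p.1 - 1)) := by
      field_simp; ring
    rw [heq] at hconc
    have hpos : 0 < 1 + s * (Φ q.1 / Φ p.1 - 1) := by nlinarith [div_pos hΦq hΦp]
    have hlog := Real.log_le_log (mul_pos hΦp hpos) hconc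
    rw [Real.log_mul hΦp.ne' hpos.ne'] at hlog
    simp only at hsup
    linarith
  rw [mul_comm, ← div_le_iff₀ hΦp]
  linarith

theorem Generates.le_mul_relativeValue {Φ : (Fin n → ℝ) → ℝ} {K : Set (openSimplex n)}
    {π : Portfolio n} (h : Generates Φ K π) {μ : ℕ → openSimplex n} (hμ : ∀ t, μ t ∈ K) (t : ℕ) :
    Φ (μ t).1 ≤ Φ (μ 0).1 * relativeValue π μ t := by
  induction t with
  | zero => simp [relativeValue]
  | succ t ih =>
    rw [relativeValue_succ, ← mul_assoc]
    exact (h.le_mul_growth (hμ t) (μ (t + 1))).trans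
      (mul_le_mul_of_nonneg_right ih (growth_nonneg _ _ fun i => ((μ (t + 1)).2.1 i).le))

theorem growth_le_sum (π : Portfolio n) (p : openSimplex n) (q : ClosedSimplex n) :
    growth π p q.1 ≤ ∑ i, (π p).1 i / p.1 i := by
  refine (growth_mono π p (r := fun _ => 1) fun i => ?_).trans_eq
    (Finset.sum_congr rfl fun i _ => mul_one_div _ _)
  exact q.2.2 ▸ Finset.single_le_sum (f := q.1) (fun j _ => q.2.1 j) (Finset.mem_univ i)

/-- If no round trip gains, the inequalities of `Generates.le_mul_growth` from `p` to `q` and back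
force `Φ q = Φ p * growth π p q`, which is linear in `q`. -/
theorem Generates.exists_one_lt_growth_mul {Φ : (Fin n → ℝ) → ℝ} {K : Set (openSimplex n)}
    {π : Portfolio n} (h : Generates Φ K π) (hΦ : ¬ IsAffineOn Φ K) :
    ∃ p ∈ K, ∃ q ∈ K, 1 < growth π p q.1 * growth π q p.1 := by
  by_contra! hcon
  refine hΦ ?_
  rcases K.eq_empty_or_nonempty with rfl | ⟨p, hp⟩
  · exact ⟨0, fun _ hp => hp.elim⟩
  let l : (Fin n → ℝ) →ₗ[ℝ] ℝ :=
    { toFun := growth π p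
      map_add' := growth_add π p
      map_smul' := growth_smul π p }
  refine ⟨(Φ p.1 • l).toAffineMap, fun q hq => le_antisymm (h.le_mul_growth hp q) ?_⟩
  have hΦp := h.pos p.1 p.2
  have h1 := h.le_mul_growth hq p
  have h2 := hcon p hp q hq
  change Φ p.1 * growth π p q.1 ≤ Φ q.1
  calc Φ p.1 * growth π p q.1 ≤ Φ q.1 * growth π q p.1 * growth π p q.1 :=
        mul_le_mul_of_nonneg_right h1 (growth_nonneg _ _ fun i => (q.2.1 i).le)
    _ = Φ q.1 * (growth π p q.1 * growth π q p.1) := by ring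
    _ ≤ Φ q.1 := mul_le_of_le_one_right (h.pos q.1 q.2).le h2

theorem exists_tendsto_relativeValue {K : Set (openSimplex n)} {π : Portfolio n}
    {p q : openSimplex n} (hp : p ∈ K) (hq : q ∈ K)
    (hpq : 1 < growth π p q.1 * growth π q p.1) :
    ∃ μ : ℕ → openSimplex n, (∀ t, μ t ∈ K) ∧ Tendsto (relativeValue π μ) atTop atTop := by
  let μ : ℕ → openSimplex n := fun t => if Even t then p else q
  have heven : ∀ k, μ (2 * k) = p := fun k => if_pos (even_two_mul k)
  have hodd : ∀ k, μ (2 * k + 1) = q := fun k => if_neg (by simp)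
  have hval : ∀ k, relativeValue π μ (2 * k) = (growth π p q.1 * growth π q p.1) ^ k := by
    intro k
    induction k with
    | zero => rfl
    | succ k ih =>
      rw [show 2 * (k + 1) = 2 * k + 1 + 1 from rfl, relativeValue_succ, relativeValue_succ,
        show 2 * k + 1 + 1 = 2 * (k + 1) from rfl, heven, heven, hodd, ih, pow_succ, mul_assoc]
  have hpos : 0 < growth π p q.1 := by
    by_contra hle
    have h0 : growth π p q.1 = 0 :=
      le_antisymm (not_lt.1 hle) (growth_nonneg _ _ fun i => (q.2.1 i).le)
    rw [h0, zero_mul] at hpq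
    linarith
  -- At odd times the path is halfway through a round trip; `c` absorbs the unfinished half.
  set c := min 1 (growth π p q.1)
  have hc : 0 < c := lt_min one_pos hpos
  refine ⟨μ, fun t => ?_, ?_⟩
  · dsimp only [μ]
    split_ifs
    exacts [hp, hq]
  · have hbound : ∀ t, c * (growth π p q.1 * growth π q p.1) ^ (t / 2) ≤ relativeValue π μ t := by
      intro t
      have hpow : 0 ≤ (growth π p q.1 * growth π q p.1) ^ (t / 2) :=
        pow_nonneg (by linarith) _
      rcases Nat.even_or_odd' t with ⟨k, rfl | rfl⟩
      · rw [Nat.mul_div_cancel_left k two_pos] at hpow ⊢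
        rw [hval]
        exact mul_le_of_le_one_left hpow (min_le_left _ _)
      · have hk : (2 * k + 1) / 2 = k := by omega
        rw [hk] at hpow ⊢
        rw [relativeValue_succ, hval, heven, hodd, mul_comm]
        exact mul_le_mul_of_nonneg_left (min_le_right _ _) hpow
    refine tendsto_atTop_mono hbound (Tendsto.const_mul_atTop hc ?_)
    exact (tendsto_pow_atTop_atTop_of_one_lt hpq).comp (Nat.tendsto_div_const_atTop two_ne_zero)

theorem Generates.isPseudoArbitrage {Φ : (Fin n → ℝ) → ℝ} {K : Set (openSimplex n)}
    {π : Portfolio n} (h : Generates Φ K π) (hΦ : ¬ IsAffineOn Φ K)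
    (hε : ∃ ε : ℝ, 0 < ε ∧ ∀ p ∈ K, ε ≤ Φ p.1) : IsPseudoArbitrage K π := by
  obtain ⟨ε, hε, hK⟩ := hε
  obtain ⟨p, hp, q, hq, hpq⟩ := h.exists_one_lt_growth_mul hΦ
  refine ⟨?_, exists_tendsto_relativeValue hp hq hpq⟩
  -- One point of `K` bounds `Φ` on the whole simplex, hence `Φ (μ 0)` uniformly over all paths.
  set M := Φ p.1 * ∑ i, (π p).1 i / p.1 i
  have hM : ∀ r : openSimplex n, Φ r.1 ≤ M := fun r => (h.le_mul_growth hp r).trans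
    (mul_le_mul_of_nonneg_left (growth_le_sum π p (toClosed r)) (h.pos p.1 p.2).le)
  have hMpos : 0 < M := (h.pos p.1 p.2).trans_le (hM p)
  refine ⟨max 0 (-Real.log (ε / M)), le_max_left _ _, fun μ hμ t => ?_⟩
  have hV : ε / M ≤ relativeValue π μ t := by
    rw [div_le_iff₀ hMpos, mul_comm]
    exact (hK _ (hμ t)).trans ((h.le_mul_relativeValue hμ t).trans
      (mul_le_mul_of_nonneg_right (hM _) (relativeValue_nonneg _ _ _)))
  have := Real.log_le_log (div_pos hε hMpos) hV
  linarith [le_max_right 0 (-Real.log (ε / M))]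

/-! ### The cost function -/

theorem continuous_expReal : Continuous expReal := by
  refine continuous_iff_continuousAt.2 fun x => ?_
  have hx : EReal.exp x.1 ≠ ⊤ := by simpa using ne_of_lt x.2
  exact (ENNReal.tendsto_toReal hx).comp
    (ENNReal.continuous_exp.comp continuous_subtype_val).continuousAt

theorem continuous_expMean :
    Continuous fun z : ClosedSimplex n × ExtSpace n => expMean z.1.1 z.2 := by
  refine continuous_finsetSum _ fun i _ => .mul (continuous_expReal.comp ?_) ?_
  · exact (continuous_apply i).comp continuous_snd
  · exact (continuous_apply i).comp (continuous_subtype_val.comp continuous_fst)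

theorem expReal_nonneg (x : Set.Iio (⊤ : EReal)) : 0 ≤ expReal x := ENNReal.toReal_nonneg

theorem expMean_nonneg {μ : Fin n → ℝ} (hμ : ∀ i, 0 ≤ μ i) (h : ExtSpace n) : 0 ≤ expMean μ h :=
  Finset.sum_nonneg fun i _ => mul_nonneg (expReal_nonneg _) (hμ i)

theorem expMean_pos (p : openSimplex n) {h : ExtSpace n} (hh : ∃ i, (h i : EReal) ≠ ⊥) :
    0 < expMean p.1 h := by
  obtain ⟨i, hi⟩ := hh
  have hpos : 0 < expReal (h i) :=
    ENNReal.toReal_pos (by simpa using hi) (by simpa using ne_of_lt (h i).2)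
  exact (mul_pos hpos (p.2.1 i)).trans_le (Finset.single_le_sum
    (f := fun i => expReal (h i) * p.1 i)
    (fun j _ => mul_nonneg (expReal_nonneg _) (p.2.1 j).le) (Finset.mem_univ i))

theorem continuous_cost : Continuous (cost (n := n)) :=
  ENNReal.continuous_log.comp (ENNReal.continuous_ofReal.comp continuous_expMean)

theorem cost_eq_log {z : ClosedSimplex n × ExtSpace n} (hz : 0 < expMean z.1.1 z.2) :
    cost z = (Real.log (expMean z.1.1 z.2) : EReal) :=
  ENNReal.log_ofReal_of_pos hz

/-- The log relative value of a cycle is the total cost after a cyclic shift minus the total cost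
before it. Each `F p` has a finite coordinate, so at points of the open simplex these costs are
finite and continuity of `cost` supplies the limits. -/
theorem IsOptimalCoupling.isMulCyclicallyMonotone {P : Measure (ClosedSimplex n)}
    {Q : Measure (ExtSpace n)} {R : Measure (ClosedSimplex n × ExtSpace n)}
    (hR : IsOptimalCoupling cost P Q R) (ht : transportValue cost P Q ≠ ⊤)
    (hb : transportValue cost P Q ≠ ⊥) {K : Set (openSimplex n)} {F : K → ExtSpace n}
    {π : Portfolio n} (hF : ∀ p : K, ∃ i, (F p i : EReal) ≠ ⊥)
    (hsupp : ∀ p : K, (toClosed p.1, F p) ∈ R.support)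
    (hπ : ∀ p : K, ∀ i, (π p.1).1 i / p.1.1 i = 1 / expMean p.1.1 (F p) * expReal (F p i)) :
    IsMulCyclicallyMonotone K π := by
  have hgrowth : ∀ (p : K) (q : Fin n → ℝ),
      growth π p.1 q = expMean q (F p) / expMean p.1.1 (F p) := by
    intro p q
    rw [expMean, Finset.sum_div]
    exact Finset.sum_congr rfl fun i _ => by
      rw [mul_div_assoc', mul_comm, ← mul_div_assoc', hπ]; ring
  have hpos : ∀ (p : K) (q : openSimplex n), 0 < expMean q.1 (F p) := fun p q =>
    expMean_pos q (hF p)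
  intro μ hμ m hm
  cases m with
  | zero => exact le_rfl
  | succ m =>
  let p : Fin (m + 1) → K := fun i => ⟨μ i, hμ i⟩
  -- At the last index the rotation wraps to `μ 0`, which equals `μ (m + 1)` because the path is
  -- closed.
  have hnext : ∀ i : Fin (m + 1), (p (finRotate (m + 1) i)).1 = μ (i + 1) := by
    intro i
    induction i using Fin.lastCases with
    | last => simp only [finRotate_last, p, Fin.val_zero, Fin.val_last, hm]
    | cast i => simp only [finRotate_apply, p, Fin.coeSucc_eq_succ, Fin.val_succ,
        Fin.val_castSucc]
  have hcost : ∀ i j, Tendsto cost (𝓝 (toClosed (p j).1, F (p i)))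
      (𝓝 ((Real.log (expMean (p j).1.1 (F (p i))) : ℝ) : EReal)) := fun i j => by
    have := continuous_cost.tendsto (toClosed (p j).1, F (p i))
    rwa [cost_eq_log (hpos _ _)] at this
  have hsum := hR.sum_le_sum_perm continuous_cost.measurable ht hb (finRotate (m + 1))
    (fun i => hsupp (p i)) (fun i => hcost i i) (fun i => hcost i (finRotate (m + 1) i))
  have hval : relativeValue π μ (m + 1) = ∏ i : Fin (m + 1),
      expMean (μ (i + 1)).1 (F (p i)) / expMean (p i).1.1 (F (p i)) := by
    rw [relativeValue_eq_prod, Finset.prod_range]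
    exact Finset.prod_congr rfl fun i _ => hgrowth (p i) _
  have hterm : ∀ i : Fin (m + 1),
      0 < expMean (μ (i + 1)).1 (F (p i)) / expMean (p i).1.1 (F (p i)) := fun i =>
    div_pos (hpos _ _) (hpos _ _)
  rw [hval, ← Real.log_nonneg_iff (Finset.prod_pos fun i _ => hterm i),
    Real.log_prod fun i _ => (hterm i).ne']
  simp only [hnext] at hsum
  rw [Finset.sum_congr rfl fun i _ => Real.log_div (hpos _ _).ne' (hpos _ _).ne',
    Finset.sum_sub_distrib]
  linarith

/-! ### Pseudo-arbitrages give optimal couplings -/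

/-- The index set may be uncountable; the infimum is measurable because it is upper semicontinuous.
-/
theorem measurable_iInf_of_continuous {Z ι : Type*} [TopologicalSpace Z] [MeasurableSpace Z]
    [OpensMeasurableSpace Z] [Nonempty ι] {f : ι → Z → ℝ} (hf : ∀ i, Continuous (f i))
    (h0 : ∀ i z, 0 ≤ f i z) : Measurable fun z => ⨅ i, f i z := by
  refine measurable_of_Iio fun a => IsOpen.measurableSet ?_
  have : (fun z => ⨅ i, f i z) ⁻¹' Set.Iio a = ⋃ i, {z | f i z < a} := by
    ext z
    simp [ciInf_lt_iff ⟨0, Set.forall_mem_range.2 fun i => h0 i z⟩]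
  rw [this]
  exact isOpen_iUnion fun i => isOpen_lt (hf i) continuous_const

theorem measurable_toClosed : Measurable (toClosed (n := n)) :=
  measurable_subtype_coe.subtype_mk

theorem expMean_logRatio (π : Portfolio n) (p : openSimplex n) (q : Fin n → ℝ) :
    expMean q (logRatio π p) = growth π p q := by
  refine Finset.sum_congr rfl fun i _ => ?_
  simp only [expReal, logRatio, ENNReal.exp_log]
  rw [ENNReal.toReal_ofReal (div_nonneg ((π p).2.1 i) (p.2.1 i).le)]
  ring

theorem pos_of_le_logRatio {π : Portfolio n} {p : openSimplex n} {i : Fin n} {m : ℝ}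
    (h : (m : EReal) ≤ (logRatio π p i : EReal)) : 0 < (π p).1 i := by
  have h1 : (⊥ : EReal) < ENNReal.log (ENNReal.ofReal ((π p).1 i / p.1 i)) :=
    (EReal.bot_lt_coe m).trans_le h
  rw [ENNReal.bot_lt_log_iff, ENNReal.ofReal_pos] at h1
  exact (div_pos_iff_of_pos_right (p.2.1 i)).1 h1

theorem integrable_of_ae_mem_Icc_log {Z : Type*} [MeasurableSpace Z] {μ : Measure Z}
    [IsFiniteMeasure μ] {f : Z → ℝ} (hf : Measurable f) {a b : ℝ} (ha : 0 < a)
    (h : ∀ᵐ z ∂μ, a ≤ f z ∧ f z ≤ b) : Integrable (fun z => Real.log (f z)) μ :=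
  Integrable.of_mem_Icc (Real.log a) (Real.log b) hf.log.aemeasurable (h.mono fun _ hz =>
    ⟨Real.log_le_log ha hz.1, Real.log_le_log (ha.trans_le hz.1) hz.2⟩)

/-- Weak duality with multiplicative potentials: if `Φ q * Ψ h ≤ expMean q h` holds wherever the
two potentials take their typical values, then the expected cost dominates the sum of the expected
logarithms of the potentials. -/
theorem integral_log_add_le_expectation {P : Measure (ClosedSimplex n)} {Q : Measure (ExtSpace n)}
    {R : Measure (ClosedSimplex n × ExtSpace n)} (hR : IsCoupling P Q R)
    {Φ : ClosedSimplex n → ℝ} {Ψ : ExtSpace n → ℝ} (hΦ : Measurable Φ) (hΨ : Measurable Ψ)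
    {a b a' b' : ℝ} (ha : 0 < a) (ha' : 0 < a') (hΦP : ∀ᵐ q ∂P, a ≤ Φ q ∧ Φ q ≤ b)
    (hΨQ : ∀ᵐ h ∂Q, a' ≤ Ψ h ∧ Ψ h ≤ b')
    (hle : ∀ q h, a ≤ Φ q → Φ q * Ψ h ≤ expMean q.1 h) :
    ((∫ q, Real.log (Φ q) ∂P + ∫ h, Real.log (Ψ h) ∂Q : ℝ) : EReal) ≤ expectation R cost := by
  have := hR.isProbability
  have hfst : ∀ᵐ z ∂ R, a ≤ Φ z.1 ∧ Φ z.1 ≤ b :=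
    ae_of_ae_map measurable_fst.aemeasurable (hR.fst_eq.symm ▸ hΦP)
  have hsnd : ∀ᵐ z ∂ R, a' ≤ Ψ z.2 ∧ Ψ z.2 ≤ b' :=
    ae_of_ae_map measurable_snd.aemeasurable (hR.snd_eq.symm ▸ hΨQ)
  have hi₁ : Integrable (fun z => Real.log (Φ z.1)) R :=
    integrable_of_ae_mem_Icc_log (hΦ.comp measurable_fst) ha hfst
  have hi₂ : Integrable (fun z => Real.log (Ψ z.2)) R :=
    integrable_of_ae_mem_Icc_log (hΨ.comp measurable_snd) ha' hsnd
  rw [← hR.fst_eq, ← hR.snd_eq,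
    integral_map measurable_fst.aemeasurable hΦ.log.aestronglyMeasurable,
    integral_map measurable_snd.aemeasurable hΨ.log.aestronglyMeasurable,
    ← integral_add hi₁ hi₂, ← expectation_coe (f := fun z => Real.log (Φ z.1) + Real.log (Ψ z.2))
      (hi₁.add hi₂)]
  refine expectation_mono ?_
  filter_upwards [hfst, hsnd] with z h1 h2
  have hΦz := ha.trans_le h1.1
  have hΨz := ha'.trans_le h2.1
  have hz := hle z.1 z.2 h1.1
  rw [cost_eq_log ((mul_pos hΦz hΨz).trans_le hz), EReal.coe_le_coe_iff,
    ← Real.log_mul hΦz.ne' hΨz.ne']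
  exact Real.log_le_log (mul_pos hΦz hΨz) hz

theorem relativeValue_pos {π : Portfolio n} {K : Set (openSimplex n)}
    (hπ : ∀ p ∈ K, ∀ i, 0 < (π p).1 i) {μ : ℕ → openSimplex n} (hμ : ∀ t, μ t ∈ K) (t : ℕ) :
    0 < relativeValue π μ t := by
  rw [relativeValue_eq_prod]
  exact Finset.prod_pos fun s _ => growth_pos (hπ _ (hμ s)) _

/-- If the relative values along sequences in `K` are bounded below by a positive constant, then
there are bounded multiplicative dual potentials that are tight along `logRatio π`. -/
theorem exists_dual_potentials {π : Portfolio n} {K : Set (openSimplex n)} (hK : K.Nonempty)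
    {a : ℝ} (ha : 0 < a)
    (hV : ∀ μ : ℕ → openSimplex n, (∀ t, μ t ∈ K) → ∀ t, a ≤ relativeValue π μ t) :
    ∃ (Φ : ClosedSimplex n → ℝ) (Ψ : ExtSpace n → ℝ) (b : ℝ), Measurable Φ ∧ Measurable Ψ ∧
      (∀ p ∈ K, a ≤ Φ (toClosed p) ∧ Φ (toClosed p) ≤ b) ∧
      (∀ p ∈ K, Ψ (logRatio π p) = (Φ (toClosed p))⁻¹) ∧
      ∀ q h, a ≤ Φ q → Φ q * Ψ h ≤ expMean q.1 h := by
  obtain ⟨p₀, hp₀⟩ := hK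
  have : Nonempty (StoppedPath K K) := ⟨⟨fun _ => p₀, fun _ => hp₀, hp₀⟩, 0⟩
  -- Chains may start anywhere in `K`: ending at a point of `K`, they are paths in `K`, so the lower
  -- bound `a` applies to them.
  let Φ : ClosedSimplex n → ℝ := fun q => chainInf π K K q.1
  have hΦlow : ∀ p ∈ K, a ≤ Φ (toClosed p) := by
    intro p hp
    refine le_ciInf fun x => ?_
    obtain ⟨ν, hν, -, -, hval⟩ := exists_relativeValue_extend π x.1.2.1 x.2 hp
    exact hval ▸ hV ν hν _
  -- Off `K` the potential `Φ` may be small or zero; restricting to `D` keeps the denominators in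
  -- `Ψ` positive.
  let D := {q : ClosedSimplex n // a ≤ Φ q}
  have : Nonempty D := ⟨toClosed p₀, hΦlow p₀ hp₀⟩
  let Ψ : ExtSpace n → ℝ := fun h => ⨅ q : D, expMean q.1.1 h / Φ q.1
  have hnonneg : ∀ (q : D) h, 0 ≤ expMean q.1.1 h / Φ q.1 := fun q h =>
    div_nonneg (expMean_nonneg q.1.2.1 h) (ha.le.trans q.2)
  have hbdd : ∀ h, BddBelow (Set.range fun q : D => expMean q.1.1 h / Φ q.1) := fun h =>
    ⟨0, Set.forall_mem_range.2 fun q => hnonneg q h⟩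
  refine ⟨Φ, Ψ, ∑ i, (π p₀).1 i / p₀.1 i, ?_, ?_, fun p hp => ⟨hΦlow p hp, ?_⟩, fun p hp => ?_,
    fun q h hq => ?_⟩
  · exact measurable_iInf_of_continuous
      (fun x => ((continuous_growth π _).comp continuous_subtype_val).const_mul _)
      fun x q => chain_nonneg π q.2.1 x
  · refine measurable_iInf_of_continuous (fun q => ?_) hnonneg
    exact (continuous_expMean.comp (Continuous.prodMk_right q.1)).div_const _
  · exact (chainInf_le_growth π hp₀ hp₀ fun i => (p.2.1 i).le).trans
      (growth_le_sum π p₀ (toClosed p))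
  -- The choice `q = p` gives the upper bound for `Ψ`; the chain inequality from `p` to `q` gives
  -- the lower bound.
  · have hp' := ha.trans_le (hΦlow p hp)
    refine le_antisymm ?_ (le_ciInf fun q => ?_)
    · refine (ciInf_le (hbdd _) ⟨toClosed p, hΦlow p hp⟩).trans_eq ?_
      dsimp only [toClosed]
      rw [expMean_logRatio, growth_self, one_div]
    · rw [expMean_logRatio, le_div_iff₀ (ha.trans_le q.2), inv_mul_le_iff₀ hp']
      exact chainInf_le_mul_growth π hp q.1.2.1
  · rw [mul_comm, ← le_div_iff₀ (ha.trans_le hq)]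
    exact ciInf_le (hbdd h) ⟨q, hq⟩

theorem IsPseudoArbitrage.isOptimalCoupling {K : Set (openSimplex n)} {π : Portfolio n}
    (h : IsPseudoArbitrage K π) (hπ : ∀ p ∈ K, ∀ i, 0 < (π p).1 i) (P : Measure K)
    [IsProbabilityMeasure P] (hT : AEMeasurable (fun p : K => logRatio π p.1) P) :
    IsOptimalCoupling cost (P.map fun p : K => toClosed p.1) (P.map fun p : K => logRatio π p.1)
      (P.map fun p : K => (toClosed p.1, logRatio π p.1)) := by
  obtain ⟨⟨C, -, hC⟩, μ, hμ, -⟩ := h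
  have htc : Measurable fun p : K => toClosed p.1 := measurable_toClosed.comp measurable_subtype_coe
  have hpair : AEMeasurable (fun p : K => (toClosed p.1, logRatio π p.1)) P :=
    htc.aemeasurable.prodMk hT
  have hcoup : IsCoupling (P.map fun p : K => toClosed p.1) (P.map fun p : K => logRatio π p.1)
      (P.map fun p : K => (toClosed p.1, logRatio π p.1)) :=
    ⟨Measure.isProbabilityMeasure_map hpair,
      AEMeasurable.map_map_of_aemeasurable measurable_fst.aemeasurable hpair,
      AEMeasurable.map_map_of_aemeasurable measurable_snd.aemeasurable hpair⟩
  have hcost : ∀ p : K, cost (toClosed p.1, logRatio π p.1) = 0 := fun p => by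
    simp [cost, expMean_logRatio, toClosed, growth_self]
  have hpos : ∫⁻ z, (cost z).toENNReal ∂(P.map fun p : K => (toClosed p.1, logRatio π p.1)) = 0 := by
    rw [lintegral_map' continuous_cost.measurable.ereal_toENNReal.aemeasurable hpair]
    simp [hcost]
  have hneg : ∫⁻ z, (-cost z).toENNReal ∂(P.map fun p : K => (toClosed p.1, logRatio π p.1)) = 0 := by
    have hm : Measurable fun z : ClosedSimplex n × ExtSpace n => (-cost z).toENNReal :=
      continuous_cost.measurable.neg.ereal_toENNReal
    rw [lintegral_map' hm.aemeasurable hpair]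
    simp [hcost]
  have hexp : HasExpectation (P.map fun p : K => (toClosed p.1, logRatio π p.1)) cost :=
    Or.inl (by rw [hpos]; exact ENNReal.zero_ne_top)
  have hexp0 : expectation (P.map fun p : K => (toClosed p.1, logRatio π p.1)) cost = 0 := by
    simp [expectation, hpos, hneg]
  refine ⟨hcoup, hexp, le_antisymm ?_ (iInf₂_le _ ⟨hcoup, hexp⟩)⟩
  rw [hexp0]
  refine le_iInf₂ fun R hR => ?_
  -- Positive weights matter here: since `Real.log 0 = 0`, a lower bound on `log V` bounds `V` from
  -- below only once `V` is known to be positive.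
  obtain ⟨Φ, Ψ, b, hΦ, hΨ, hΦK, hΨK, hle⟩ := exists_dual_potentials (π := π) ⟨μ 0, hμ 0⟩
    (Real.exp_pos (-C)) fun ν hν t =>
      (Real.le_log_iff_exp_le (relativeValue_pos hπ hν t)).1 (hC ν hν t)
  have ha := Real.exp_pos (-C)
  have hb : 0 < b := ha.trans_le ((hΦK _ (hμ 0)).1.trans (hΦK _ (hμ 0)).2)
  have hdual := integral_log_add_le_expectation hR.1 hΦ hΨ ha (inv_pos.2 hb)
    (b := b) (b' := (Real.exp (-C))⁻¹)
    ((ae_map_iff htc.aemeasurable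
      ((measurableSet_le measurable_const hΦ).inter (measurableSet_le hΦ measurable_const))).2
      (ae_of_all _ fun p => hΦK p.1 p.2))
    ((ae_map_iff hT
      ((measurableSet_le measurable_const hΨ).inter (measurableSet_le hΨ measurable_const))).2
      (ae_of_all _ fun p => by
        have h1 := hΦK p.1 p.2
        change b⁻¹ ≤ Ψ (logRatio π p.1) ∧ Ψ (logRatio π p.1) ≤ (Real.exp (-C))⁻¹
        rw [hΨK p.1 p.2]
        exact ⟨inv_anti₀ (ha.trans_le h1.1) h1.2, inv_anti₀ ha h1.1⟩))
    hle
  rw [integral_map htc.aemeasurable hΦ.log.aestronglyMeasurable,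
    integral_map hT hΨ.log.aestronglyMeasurable] at hdual
  have hzero : ∫ p : K, Real.log (Φ (toClosed p.1)) ∂P +
      ∫ p : K, Real.log (Ψ (logRatio π p.1)) ∂P = 0 := by
    have : (fun p : K => Real.log (Ψ (logRatio π p.1))) =
        fun p : K => -Real.log (Φ (toClosed p.1)) := by
      funext p
      rw [hΨK p.1 p.2, Real.log_inv]
    rw [this, integral_neg, add_neg_cancel]
  rwa [hzero] at hdual

end PseudoArbitrage

end

open PseudoArbitrage in
theorem theorem2 (n : ℕ) :
    -- optimal couplings give functionally generated portfolios
    (∀ (P : Measure (ClosedSimplex n)) (Q : Measure (ExtSpace n))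
        (R : Measure (ClosedSimplex n × ExtSpace n)),
      IsProbabilityMeasure P → IsProbabilityMeasure Q →
      (∀ᵐ p ∂P, p.1 ∈ openSimplex n) →
      IsOptimalCoupling cost P Q R →
      transportValue cost P Q ≠ ⊤ → transportValue cost P Q ≠ ⊥ →
      ∀ (K : Set (openSimplex n)) (F : K → ExtSpace n) (π : Portfolio n),
        (∀ p : K, ∃ i, (F p i : EReal) ≠ ⊥) →
        (∀ p : K, (toClosed p.1, F p) ∈ R.support) →
        (∀ p : K, ∀ i, (π p.1).1 i / p.1.1 i = 1 / expMean p.1.1 (F p) * expReal (F p i)) →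
        (∃ Φ : (Fin n → ℝ) → ℝ, Generates Φ K π) ∧
        (∀ Φ : (Fin n → ℝ) → ℝ, Generates Φ K π →
          IsOpen K → Convex ℝ (Subtype.val '' K) →
          ¬ IsAffineOn Φ K → (∃ ε : ℝ, 0 < ε ∧ ∀ p ∈ K, ε ≤ Φ p.1) →
          IsPseudoArbitrage K π)) ∧
    -- pseudo-arbitrages give optimal couplings
    (∀ (K : Set (openSimplex n)) (π : Portfolio n),
      IsPseudoArbitrage K π →
      (∀ i, ∃ m : ℝ, ∀ p ∈ K, (m : EReal) ≤ (logRatio π p i : EReal)) →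
      ∀ P : Measure K, IsProbabilityMeasure P →
        AEMeasurable (fun p : K => logRatio π p.1) P →
        IsOptimalCoupling cost
          (P.map fun p : K => toClosed p.1)
          (P.map fun p : K => logRatio π p.1)
          (P.map fun p : K => (toClosed p.1, logRatio π p.1))) := by
  refine ⟨fun P Q R _ _ _ hR ht hb K F π hF hsupp hπ => ⟨?_, fun Φ hΦ _ _ haff hε => ?_⟩,
    fun K π h hT P _ hm => ?_⟩
  · exact (hR.isMulCyclicallyMonotone ht hb hF hsupp hπ).exists_generates
  · exact hΦ.isPseudoArbitrage haff hε
  · exact h.isOptimalCoupling (fun p hp i => pos_of_le_logRatio ((hT i).choose_spec p hp)) P hm
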